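/- **Proposition (diffuse waves).** Let $k>0$ and $0<a<R$. Let $B_a\subset\mathbb R^3$ be the ball of radius $a$ and $\partial B_R$ the sphere of radius $R$, both centered at the origin, with Lebesgue measure and surface measure respectively, and let $G(x,y)=\dfrac{e^{-k|x-y|}}{4\pi|x-y|}$. Put $X=L^2(B_a)$ and $Y=L^2(\partial B_R\times\partial B_R)$ (real- or complex-valued functions). For $m\ge 1$ and $\eta_1,\dots,\eta_m\in X$ let $$K_m(\eta_1,\dots,\eta_m)(x,y)=-(-k^2)^m\int_{B_a}\!\!\cdots\int_{B_a}G(x,z_1)G(z_1,z_2)\cdots G(z_{m-1},z_m)G(z_m,y)\,\eta_1(z_1)\cdots\eta_m(z_m)\,dz_1\cdots dz_m ,$$ for $x,y\in\partial B_R$. These integrals converge absolutely and $K_m(\eta_1,\dots,\eta_m)\in Y$. Given a bounded linear operator $\mathcal K_1:Y\to X$ and $\phi\in Y$, the inverse Born series is $\sum_{m=1}^\infty\mathcal K_m(\phi)$, where $\mathcal K_1(\phi)=\mathcal K_1\phi$ and, for $m\ge2$, $$\mathcal K_m(\phi)=-\sum_{n=2}^m\ \sum_{\substack{i_1+\cdots+i_n=m\\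 i_j\ge1}}\mathcal K_1K_n\big(\mathcal K_{i_1}(\phi),\dots,\mathcal K_{i_n}(\phi)\big).$$ Let $$\nu=k^2|B_a|^{1/2}\,\frac{R}{16\pi a}\log\left|\frac{(R+a)^2}{(R-a)^2}\right|,\qquad \mu=k^2\sqrt{\frac{a}{4\pi}} .$$ Then for every bounded linear operator $\mathcal K_1:Y\to X$, with $C=\max\{1,\|\mathcal K_1\|\nu\}$, the inverse Born series converges in $L^2(B_a)$ for all $\phi\in Y$ such that $$\|\mathcal K_1\phi\|_{L^2(B_a)}\le\frac1{2\mu}\left[\sqrt{16C^2+1}-4C\right].$$ -/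

import Mathlib

open MeasureTheory Filter Topology Finset
open scoped ENNReal

noncomputable section

namespace DiffuseBorn

/-- Physical space `ℝ³`, with the Euclidean norm and Lebesgue measure. -/
abbrev R3 : Type := EuclideanSpace ℝ (Fin 3)

/-- The Green's function `G(x,y) = e^{-k|x-y|} / (4π|x-y|)`. -/
def green (k : ℝ) (x y : R3) : ℝ :=
  Real.exp (-k * ‖x - y‖) / (4 * Real.pi * ‖x - y‖)

/-- Lebesgue measure on the ball `B_a` of radius `a` centered at the origin. -/
def ballMeasure (a : ℝ) : Measure R3 :=
  volume.restrict (Metric.ball (0 : R3) a)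

/-- Surface measure on the sphere `∂B_R`, as a measure on `ℝ³` carried by that sphere: the image of
the surface measure of the unit sphere under `ω ↦ R ω`, multiplied by `R²`. -/
def sphereMeasure (R : ℝ) : Measure R3 :=
  ENNReal.ofReal (R ^ 2) •
    ((volume : Measure R3).toSphere.map fun ω : Metric.sphere (0 : R3) 1 => R • (ω : R3))

/-- The space `L²(B_a)`, over the scalar field `𝕜 = ℝ` or `ℂ`. -/
abbrev BallL2 (𝕜 : Type*) [RCLike 𝕜] (a : ℝ) : Type _ :=
  Lp 𝕜 2 (ballMeasure a)

/-- The space `L²(∂B_R × ∂B_R)`, over the scalar field `𝕜 = ℝ` or `ℂ`. -/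
abbrev DataL2 (𝕜 : Type*) [RCLike 𝕜] (R : ℝ) : Type _ :=
  Lp 𝕜 2 ((sphereMeasure R).prod (sphereMeasure R))

variable {𝕜 : Type*} [RCLike 𝕜]

/-- The integrand of the Born operator of order `m = n + 1`, with the variables
`z₁, …, z_m` written `z 0, …, z n`:
`G(x,z₁) G(z₁,z₂) ⋯ G(z_{m-1},z_m) G(z_m,y) η₁(z₁) ⋯ η_m(z_m)`. -/
def bornIntegrand (k : ℝ) {n : ℕ} (η : Fin (n + 1) → R3 → 𝕜) (x y : R3)
    (z : Fin (n + 1) → R3) : 𝕜 :=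
  ((green k x (z 0) * (∏ i : Fin n, green k (z i.castSucc) (z i.succ)) *
      green k (z (Fin.last n)) y : ℝ) : 𝕜) * ∏ i, η i (z i)

/-- The function `(x,y) ↦ K_m(η₁, …, η_m)(x,y)` for `m = n + 1`:
`-(-k²)^m` times the integral of `bornIntegrand` over `B_a × ⋯ × B_a`. -/
def bornFunction (k a : ℝ) {n : ℕ} (η : Fin (n + 1) → R3 → 𝕜) (p : R3 × R3) : 𝕜 :=
  ((-(-k ^ 2) ^ (n + 1) : ℝ) : 𝕜) *
    ∫ z, bornIntegrand k η p.1 p.2 z ∂(Measure.pi fun _ : Fin (n + 1) => ballMeasure a)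

open Classical in
/-- The forward operators `K_m : L²(B_a)^m → L²(∂B_R × ∂B_R)`, `m ≥ 1` (the value for `m = 0` is
not used). That `bornFunction` is square integrable, so that the first alternative always applies,
is part of the main theorem. -/
def bornOperator (k a R : ℝ) : (m : ℕ) → (Fin m → BallL2 𝕜 a) → DataL2 𝕜 R
  | 0, _ => 0
  | _ + 1, η =>
    if h : MemLp (bornFunction k a fun i => (η i : R3 → 𝕜)) 2
        ((sphereMeasure R).prod (sphereMeasure R))
    then h.toLp _ else 0

/-- Each block of a composition with at least two blocks is smaller than the total. -/
theorem blocksFun_lt {m : ℕ} (c : Composition m) (hc : 2 ≤ c.length) (i : Fin c.length) :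
    c.blocksFun i < m := by
  have hm : 0 < m := lt_of_lt_of_le (by omega) c.length_le
  have h1 : c ≠ Composition.single m hm := by
    intro h
    have := (Composition.eq_single_iff_length hm).1 h
    omega
  exact (Composition.ne_single_iff hm).1 h1 i

/-- The inverse operators `𝒦_m : Y → X` determined by forward operators `K_m : X^m → Y` and a
bounded linear operator `𝒦_1 : Y → X`, evaluated at `φ`: for `m ≥ 2`,
`𝒦_m(φ) = - ∑_{n=2}^m ∑_{i_1 + ⋯ + i_n = m} 𝒦_1 K_n(𝒦_{i_1}(φ), …, 𝒦_{i_n}(φ))`.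
The double sum runs over the compositions of `m` into `n ≥ 2` positive parts `i_1, …, i_n`.
(The value for `m = 0` is not used.) -/
def inverseBornTerm {X Y : Type*} [NormedAddCommGroup X] [NormedSpace 𝕜 X]
    [NormedAddCommGroup Y] [NormedSpace 𝕜 Y]
    (K : (m : ℕ) → (Fin m → X) → Y) (K1 : Y →L[𝕜] X) (φ : Y) : ℕ → X
  | 0 => 0
  | 1 => K1 φ
  | m + 2 =>
    -∑ c : { c : Composition (m + 2) // 2 ≤ c.length },
      K1 (K c.1.length fun i => inverseBornTerm K K1 φ (c.1.blocksFun i))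
  decreasing_by exact blocksFun_lt c.1 c.2 i

/-- `∑_{m=1}^∞ u_m` converges: its partial sums have a limit. -/
def SeriesConverges {X : Type*} [NormedAddCommGroup X] (u : ℕ → X) : Prop :=
  ∃ s : X, Tendsto (fun N : ℕ => ∑ m ∈ Finset.Icc 1 N, u m) atTop (𝓝 s)

/-- `ν = k² |B_a|^{1/2} (R / 16πa) log |(R+a)² / (R-a)²|`. -/
def nu (k a R : ℝ) : ℝ :=
  k ^ 2 * Real.sqrt (volume.real (Metric.ball (0 : R3) a)) * (R / (16 * Real.pi * a)) *
    Real.log |(R + a) ^ 2 / (R - a) ^ 2|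

/-- `μ = k² √(a / 4π)`. -/
def mu (k a : ℝ) : ℝ :=
  k ^ 2 * Real.sqrt (a / (4 * Real.pi))

end DiffuseBorn

end

/-!
The proof has an analytic half, the bound `‖K_m(η₁, …, η_m)‖ ≤ ν μ^{m-1} ‖η₁‖ ⋯ ‖η_m‖`
(`norm_bornOperator_le`), and a combinatorial half, which uses nothing else about the forward
operators (`seriesConverges_inverseBornTerm`).

For the bound, drop the exponential in `G`. The Cauchy–Schwarz inequality with respect to the
measure on `B_a^m` whose density is the product of the inner factors `G(z_i, z_{i+1})` and of the
`|η_i(z_i)|`, followed by Tonelli's theorem, bounds the `L²` norm of `K_m(η₁, …, η_m)` by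
`k^{2m}` times the total mass of that measure times the supremum over `z ∈ B_a` of
`∫ G(x,z)² dS(x)` (`lintegral_sq_lintegral_mul_le`).

* The supremum comes from the explicit value of `∫ |x - z|⁻² dS(x)` over `∂B_R`. By Archimedes'
  theorem the surface measure of the unit sphere projects to a uniform measure on each axis
  (`lintegral_toSphere_inner`), so the integral is `2πR/r · log((R+r)/(R-r))` with `r = |z|`, which
  increases with `r` (`log_sub_log_div_le`). This gives the logarithmic factor of `ν`.
* The total mass is bounded by integrating out one variable after the other. Each kernel costs a
  factor `sup_x ‖G(x, ·)‖_{L²(B_a)} ≤ √(a/4π)`, because `∫ |x - z|⁻² dz` over `B_a` is largest for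
  `x = 0` (`lintegral_ball_inv_sq_sub_le`), and the first variable costs `|B_a|^{1/2}`
  (`lintegral_chain_le`).

For the convergence, the norms `b_m = ‖𝒦_m(φ)‖` satisfy, for `m ≥ 2`,
`b_m ≤ (C/μ) ∑ μ^n b_{i_1} ⋯ b_{i_n}`, a sum over the compositions of `m` into `n ≥ 2` parts.
Summing over `m` and extending the sum to all `n`-tuples of bounded indices gives
`S_{N+1} ≤ b_1 + (C/μ) q²/(1-q)` with `q = μ S_N`, for the partial sums `S_N = b_1 + ⋯ + b_N`. The
hypothesis on `φ` implies `μ b_1 ≤ 1/(16C)`, and then the bound `S_N ≤ 1/(8Cμ)` propagates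
(`sum_norm_inverseBornTerm_le`). So the series converges absolutely.
-/

namespace DiffuseBorn

/-! ### Spherical integrals -/

/-- Integration in polar coordinates in `ℝ³`. -/
theorem lintegral_eq_lintegral_toSphere {F : R3 → ℝ≥0∞} (hF : Measurable F) :
    ∫⁻ x, F x = ∫⁻ ω : Metric.sphere (0 : R3) 1, ∫⁻ r in Set.Ioi (0 : ℝ),
      ENNReal.ofReal (r ^ 2) * F (r • (ω : R3)) ∂volume ∂(volume : Measure R3).toSphere := by
  have hmeas : Measurable fun p : Metric.sphere (0 : R3) 1 × Set.Ioi (0 : ℝ) =>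
      F ((p.2 : ℝ) • (p.1 : R3)) := hF.comp (by fun_prop)
  calc ∫⁻ x, F x = ∫⁻ x in ({0}ᶜ : Set R3), F x := by
        rw [restrict_compl_singleton]
    _ = ∫⁻ x : ({0}ᶜ : Set R3), F x ∂((volume : Measure R3).comap Subtype.val) :=
        (lintegral_subtype_comap (measurableSet_singleton (0 : R3)).compl F).symm
    _ = ∫⁻ x : ({0}ᶜ : Set R3), F (((homeomorphUnitSphereProd R3 x).2 : ℝ) •
          ((homeomorphUnitSphereProd R3 x).1 : R3)) ∂((volume : Measure R3).comap Subtype.val) := by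
        refine lintegral_congr fun x => ?_
        have hx : ‖(x : R3)‖ ≠ 0 := norm_ne_zero_iff.2 x.2
        simp [smul_smul, hx]
    _ = ∫⁻ p, F ((p.2 : ℝ) • (p.1 : R3))
          ∂((volume : Measure R3).toSphere.prod (Measure.volumeIoiPow 2)) := by
        have h := (volume : Measure R3).measurePreserving_homeomorphUnitSphereProd
        rw [show Module.finrank ℝ R3 - 1 = 2 by simp] at h
        exact h.lintegral_comp hmeas
    _ = _ := by
        rw [lintegral_prod _ hmeas.aemeasurable]
        refine lintegral_congr fun ω => ?_
        have hω : Measurable fun r : ℝ => F (r • (ω : R3)) := hF.comp (by fun_prop)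
        refine (lintegral_withDensity_eq_lintegral_mul _
          (f := fun r : Set.Ioi (0 : ℝ) => ENNReal.ofReal ((r : ℝ) ^ 2)) (by fun_prop)
          (hω.comp measurable_subtype_coe)).trans ?_
        exact lintegral_subtype_comap measurableSet_Ioi
          (fun r : ℝ => ENNReal.ofReal (r ^ 2) * F (r • (ω : R3)))

/-- Cylindrical coordinates, followed by polar coordinates in the half-plane of the pairs
(height, distance from the axis): the integral of a function that is axially symmetric. -/
theorem lintegral_axial {F : ℝ → ℝ → ℝ≥0∞} (hF : Measurable (Function.uncurry F)) :
    ∫⁻ x : R3, F (x 0) (Real.sqrt (x 1 ^ 2 + x 2 ^ 2)) =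
      ENNReal.ofReal (2 * Real.pi) * ∫⁻ r in Set.Ioi (0 : ℝ), ∫⁻ θ in Set.Ioo 0 Real.pi,
        ENNReal.ofReal (r ^ 2 * Real.sin θ) * F (r * Real.cos θ) (r * Real.sin θ) := by
  have hF2 : ∀ {α : Type} [MeasurableSpace α] {u v : α → ℝ}, Measurable u → Measurable v →
      Measurable fun x => F (u x) (v x) := fun hu hv => hF.comp (hu.prodMk hv)
  -- integration over the circles around the axis
  have hplane : ∀ s : ℝ, ∫⁻ q : ℝ × ℝ, F s (Real.sqrt (q.1 ^ 2 + q.2 ^ 2)) =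
      ENNReal.ofReal (2 * Real.pi) * ∫⁻ ρ in Set.Ioi (0 : ℝ), ENNReal.ofReal ρ * F s ρ := by
    intro s
    rw [← lintegral_comp_polarCoord_symm, polarCoord_target, Measure.volume_eq_prod,
      ← Measure.prod_restrict, lintegral_prod _ (by
        simp only [polarCoord_symm_apply, smul_eq_mul]
        exact (Measurable.mul (by fun_prop) (hF2 (by fun_prop) (by fun_prop))).aemeasurable),
      ← lintegral_const_mul _ (f := fun ρ => ENNReal.ofReal ρ * F s ρ)
        (Measurable.mul (by fun_prop) (hF2 (by fun_prop) (by fun_prop)))]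
    refine setLIntegral_congr_fun measurableSet_Ioi fun ρ hρ => ?_
    have hρ' : (0 : ℝ) < ρ := hρ
    have : ∀ θ : ℝ, Real.sqrt ((ρ * Real.cos θ) ^ 2 + (ρ * Real.sin θ) ^ 2) = ρ := by
      intro θ
      rw [show (ρ * Real.cos θ) ^ 2 + (ρ * Real.sin θ) ^ 2
        = ρ ^ 2 * (Real.sin θ ^ 2 + Real.cos θ ^ 2) by ring, Real.sin_sq_add_cos_sq, mul_one,
        Real.sqrt_sq hρ'.le]
    simp only [polarCoord_symm_apply, this, smul_eq_mul, lintegral_const,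
      Measure.restrict_apply_univ, Real.volume_Ioo]
    rw [mul_comm, sub_neg_eq_add, ← two_mul]
  have hmeas : Measurable ((Prod.snd ⁻¹' Set.Ioi (0 : ℝ)).indicator
      fun p : ℝ × ℝ => ENNReal.ofReal p.2 * F p.1 p.2) :=
    Measurable.indicator (Measurable.mul (by fun_prop) hF) (measurable_snd measurableSet_Ioi)
  calc ∫⁻ x : R3, F (x 0) (Real.sqrt (x 1 ^ 2 + x 2 ^ 2))
      = ∫⁻ x : Fin 3 → ℝ, F (x 0) (Real.sqrt (x 1 ^ 2 + x 2 ^ 2)) :=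
        (PiLp.volume_preserving_ofLp (Fin 3)).lintegral_comp
          (f := fun x : Fin 3 → ℝ => F (x 0) (Real.sqrt (x 1 ^ 2 + x 2 ^ 2)))
          (hF2 (by fun_prop) (by fun_prop))
    _ = ∫⁻ p : ℝ × (Fin 2 → ℝ), F p.1 (Real.sqrt (p.2 0 ^ 2 + p.2 1 ^ 2)) :=
        (volume_preserving_piFinSuccAbove (fun _ : Fin 3 => ℝ) 0).lintegral_comp
          (f := fun p : ℝ × (Fin 2 → ℝ) => F p.1 (Real.sqrt (p.2 0 ^ 2 + p.2 1 ^ 2)))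
          (hF2 (by fun_prop) (by fun_prop))
    _ = ∫⁻ s : ℝ, ∫⁻ q : Fin 2 → ℝ, F s (Real.sqrt (q 0 ^ 2 + q 1 ^ 2)) :=
        lintegral_prod _ (hF2 (by fun_prop) (by fun_prop)).aemeasurable
    _ = ∫⁻ s : ℝ, ∫⁻ q : ℝ × ℝ, F s (Real.sqrt (q.1 ^ 2 + q.2 ^ 2)) := by
        refine lintegral_congr fun s => ?_
        exact (volume_preserving_finTwoArrow ℝ).lintegral_comp
          (f := fun q : ℝ × ℝ => F s (Real.sqrt (q.1 ^ 2 + q.2 ^ 2)))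
          (hF2 (by fun_prop) (by fun_prop))
    _ = ENNReal.ofReal (2 * Real.pi) *
          ∫⁻ s : ℝ, ∫⁻ ρ in Set.Ioi (0 : ℝ), ENNReal.ofReal ρ * F s ρ := by
        simp_rw [hplane]
        refine lintegral_const_mul _ (Measurable.lintegral_prod_right' (f := fun p : ℝ × ℝ =>
          ENNReal.ofReal p.2 * F p.1 p.2) (Measurable.mul (by fun_prop) hF))
    _ = ENNReal.ofReal (2 * Real.pi) * ∫⁻ p : ℝ × ℝ, (Prod.snd ⁻¹' Set.Ioi (0 : ℝ)).indicator
          (fun p : ℝ × ℝ => ENNReal.ofReal p.2 * F p.1 p.2) p := by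
        congr 1
        rw [Measure.volume_eq_prod, lintegral_prod _ hmeas.aemeasurable]
        refine lintegral_congr fun s => ?_
        rw [← lintegral_indicator measurableSet_Ioi]
        rfl
    _ = _ := by
        congr 1
        have hmeas' : Measurable fun p : ℝ × ℝ => ENNReal.ofReal p.1 •
            (Prod.snd ⁻¹' Set.Ioi (0 : ℝ)).indicator
              (fun p : ℝ × ℝ => ENNReal.ofReal p.2 * F p.1 p.2) (polarCoord.symm p) := by
          simp only [polarCoord_symm_apply, smul_eq_mul]
          exact Measurable.mul (by fun_prop) (hmeas.comp (by fun_prop))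
        rw [← lintegral_comp_polarCoord_symm, polarCoord_target, Measure.volume_eq_prod,
          ← Measure.prod_restrict, lintegral_prod _ hmeas'.aemeasurable]
        refine setLIntegral_congr_fun measurableSet_Ioi fun r hr => ?_
        have hr' : (0 : ℝ) < r := hr
        have hsub : Set.Ioo 0 Real.pi ⊆ Set.Ioo (-Real.pi) Real.pi :=
          Set.Ioo_subset_Ioo_left (by linarith [Real.pi_pos])
        rw [← lintegral_indicator measurableSet_Ioo, ← lintegral_indicator measurableSet_Ioo]
        refine lintegral_congr fun θ => ?_
        by_cases h1 : θ ∈ Set.Ioo 0 Real.pi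
        · have hs : 0 < Real.sin θ := Real.sin_pos_of_pos_of_lt_pi h1.1 h1.2
          rw [Set.indicator_of_mem (hsub h1), Set.indicator_of_mem h1]
          simp only [polarCoord_symm_apply, smul_eq_mul]
          rw [Set.indicator_of_mem (show (r * Real.cos θ, r * Real.sin θ) ∈
              Prod.snd ⁻¹' Set.Ioi (0 : ℝ) from mul_pos hr' hs),
            ← mul_assoc, ← ENNReal.ofReal_mul hr'.le]
          congr 2; ring
        · rw [Set.indicator_of_notMem h1]
          by_cases h2 : θ ∈ Set.Ioo (-Real.pi) Real.pi
          · rw [Set.indicator_of_mem h2]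
            have hs : Real.sin θ ≤ 0 := by
              refine Real.sin_nonpos_of_nonpos_of_neg_pi_le ?_ h2.1.le
              by_contra hc
              exact h1 ⟨not_le.1 hc, h2.2⟩
            simp only [polarCoord_symm_apply, smul_eq_mul]
            rw [Set.indicator_of_notMem, mul_zero]
            exact not_lt.2 (mul_nonpos_of_nonneg_of_nonpos hr'.le hs)
          · rw [Set.indicator_of_notMem h2]

theorem exists_linearIsometryEquiv_apply_eq {e : R3} (he : ‖e‖ = 1) :
    ∃ U : R3 ≃ₗᵢ[ℝ] R3, U (EuclideanSpace.single 0 1) = e :=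
  ⟨(ℝ ∙ (EuclideanSpace.single 0 1 - e))ᗮ.reflection,
    Submodule.reflection_sub (by simp [he])⟩

/-- The projection of the surface measure of the unit sphere onto an axis is uniform: the density
`2π dt` on `[-1, 1]`, written here in terms of the polar angle `θ`, where `t = cos θ`. It is
obtained by integrating, over the unit ball, the function that is constant on rays. -/
theorem lintegral_toSphere_inner {f : ℝ → ℝ≥0∞} (hf : Measurable f) {e : R3} (he : ‖e‖ = 1) :
    ∫⁻ ω : Metric.sphere (0 : R3) 1, f (inner ℝ e (ω : R3)) ∂(volume : Measure R3).toSphere =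
      ENNReal.ofReal (2 * Real.pi) *
        ∫⁻ θ in Set.Ioo 0 Real.pi, ENNReal.ofReal (Real.sin θ) * f (Real.cos θ) := by
  obtain ⟨U, hU⟩ := exists_linearIsometryEquiv_apply_eq he
  set c : ℝ≥0∞ := ∫⁻ r in Set.Ioi (0 : ℝ),
    ENNReal.ofReal (r ^ 2) * (Set.Iio (1 : ℝ)).indicator 1 r with hc
  have hcm : Measurable fun r : ℝ =>
      ENNReal.ofReal (r ^ 2) * (Set.Iio (1 : ℝ)).indicator 1 r :=
    Measurable.mul (by fun_prop) (measurable_one.indicator measurableSet_Iio)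
  have hω : Measurable fun ω : Metric.sphere (0 : R3) 1 => f (inner ℝ e (ω : R3)) :=
    hf.comp (by fun_prop)
  have hcval : c = ∫⁻ r in Set.Ioo (0 : ℝ) 1, ENNReal.ofReal (r ^ 2) := by
    rw [hc, ← lintegral_indicator measurableSet_Ioi, ← lintegral_indicator measurableSet_Ioo]
    refine lintegral_congr fun r => ?_
    by_cases h0 : 0 < r <;> by_cases h1 : r < 1 <;> simp [Set.indicator, h0, h1]
  have hc0 : c ≠ 0 := by
    rw [hcval, ← pos_iff_ne_zero, setLIntegral_pos_iff (by fun_prop)]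
    have : Set.Ioo (0 : ℝ) 1 ⊆ (Function.support fun r : ℝ => ENNReal.ofReal (r ^ 2)) ∩
        Set.Ioo 0 1 := fun r hr => ⟨by simpa using hr.1.ne', hr⟩
    exact lt_of_lt_of_le (by simp) (measure_mono this)
  have hctop : c ≠ ∞ := by
    rw [hcval]
    refine (setLIntegral_lt_top_of_le_nnreal (s := Set.Ioo (0 : ℝ) 1) (by simp)
      ⟨1, fun r hr => ?_⟩).ne
    rw [ENNReal.coe_one, ENNReal.ofReal_le_one]
    exact pow_le_one₀ hr.1.le hr.2.le
  have hF : Measurable fun x : R3 =>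
      (Set.Iio (1 : ℝ)).indicator 1 ‖x‖ * f (inner ℝ e x / ‖x‖) :=
    Measurable.mul ((measurable_one.indicator measurableSet_Iio).comp measurable_norm)
      (hf.comp (by fun_prop))
  have h1 : ∫⁻ x : R3, (Set.Iio (1 : ℝ)).indicator 1 ‖x‖ * f (inner ℝ e x / ‖x‖) =
      c * ∫⁻ ω : Metric.sphere (0 : R3) 1, f (inner ℝ e (ω : R3))
        ∂(volume : Measure R3).toSphere := by
    rw [lintegral_eq_lintegral_toSphere hF, ← lintegral_const_mul _ hω]
    refine lintegral_congr fun ω => ?_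
    rw [hc, ← lintegral_mul_const _ hcm]
    refine setLIntegral_congr_fun measurableSet_Ioi fun r hr => ?_
    have hr' : (0 : ℝ) < r := hr
    have hω : ‖r • (ω : R3)‖ = r := by simp [norm_smul, abs_of_pos hr']
    simp only [hω, inner_smul_right]
    rw [mul_div_cancel_left₀ _ hr'.ne', mul_assoc]
  have h2 : ∫⁻ x : R3, (Set.Iio (1 : ℝ)).indicator 1 ‖x‖ * f (inner ℝ e x / ‖x‖) =
      c * (ENNReal.ofReal (2 * Real.pi) *
        ∫⁻ θ in Set.Ioo 0 Real.pi, ENNReal.ofReal (Real.sin θ) * f (Real.cos θ)) := by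
    have hax : Measurable (Function.uncurry fun s ρ : ℝ =>
        (Set.Iio (1 : ℝ)).indicator (1 : ℝ → ℝ≥0∞) (Real.sqrt (s ^ 2 + ρ ^ 2)) *
          f (s / Real.sqrt (s ^ 2 + ρ ^ 2))) :=
      Measurable.mul ((measurable_one.indicator measurableSet_Iio).comp (by fun_prop))
        (hf.comp (by fun_prop))
    calc _ = ∫⁻ x : R3, (Set.Iio (1 : ℝ)).indicator 1 ‖x‖ * f (x 0 / ‖x‖) := by
          rw [← U.measurePreserving.lintegral_comp hF]
          refine lintegral_congr fun x => ?_
          rw [← hU, U.norm_map, U.inner_map_map, EuclideanSpace.inner_single_left]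
          simp
      _ = ∫⁻ x : R3, (Set.Iio (1 : ℝ)).indicator (1 : ℝ → ℝ≥0∞)
            (Real.sqrt (x 0 ^ 2 + Real.sqrt (x 1 ^ 2 + x 2 ^ 2) ^ 2)) *
          f (x 0 / Real.sqrt (x 0 ^ 2 + Real.sqrt (x 1 ^ 2 + x 2 ^ 2) ^ 2)) := by
          refine lintegral_congr fun x => ?_
          rw [Real.sq_sqrt (by positivity), EuclideanSpace.norm_eq, Fin.sum_univ_three]
          simp [add_assoc]
      _ = ENNReal.ofReal (2 * Real.pi) * ∫⁻ r in Set.Ioi (0 : ℝ), ∫⁻ θ in Set.Ioo 0 Real.pi,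
            ENNReal.ofReal (r ^ 2) * (Set.Iio (1 : ℝ)).indicator 1 r *
              (ENNReal.ofReal (Real.sin θ) * f (Real.cos θ)) := by
          rw [lintegral_axial hax]
          congr 1
          refine setLIntegral_congr_fun measurableSet_Ioi fun r hr => ?_
          refine lintegral_congr fun θ => ?_
          have hr' : (0 : ℝ) < r := hr
          rw [show (r * Real.cos θ) ^ 2 + (r * Real.sin θ) ^ 2
            = r ^ 2 * (Real.sin θ ^ 2 + Real.cos θ ^ 2) by ring, Real.sin_sq_add_cos_sq, mul_one,
            Real.sqrt_sq hr'.le, mul_div_cancel_left₀ _ hr'.ne', ENNReal.ofReal_mul (by positivity)]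
          ring
      _ = _ := by
          have hm : Measurable fun θ : ℝ => ENNReal.ofReal (Real.sin θ) * f (Real.cos θ) :=
            Measurable.mul (by fun_prop) (hf.comp (by fun_prop))
          simp_rw [lintegral_const_mul _ hm]
          rw [lintegral_mul_const _ hcm, ← hc]
          ring
  exact (ENNReal.mul_right_inj hc0 hctop).1 (h1.symm.trans h2)

/-- The elementary integral `∫₀^π sin θ / (R² + r² - 2Rr cos θ) dθ`. -/
theorem lintegral_sin_div {r R : ℝ} (hr : 0 < r) (hrR : r < R) :
    ∫⁻ θ in Set.Ioo 0 Real.pi, ENNReal.ofReal (Real.sin θ) *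
        ENNReal.ofReal (R ^ 2 + r ^ 2 - 2 * R * r * Real.cos θ)⁻¹ =
      ENNReal.ofReal ((Real.log (R + r) - Real.log (R - r)) / (R * r)) := by
  have hR : 0 < R := hr.trans hrR
  have hpos : ∀ θ : ℝ, 0 < R ^ 2 + r ^ 2 - 2 * R * r * Real.cos θ := by
    intro θ
    nlinarith [mul_pos hR hr, Real.cos_le_one θ, sq_pos_of_pos (sub_pos.2 hrR),
      mul_nonneg (mul_pos hR hr).le (sub_nonneg.2 (Real.cos_le_one θ))]
  have hcont : Continuous fun θ : ℝ =>
      Real.sin θ * (R ^ 2 + r ^ 2 - 2 * R * r * Real.cos θ)⁻¹ :=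
    Real.continuous_sin.mul (Continuous.inv₀ (by fun_prop) fun θ => (hpos θ).ne')
  have hderiv : ∀ θ ∈ Set.uIcc 0 Real.pi, HasDerivAt
      (fun θ => Real.log (R ^ 2 + r ^ 2 - 2 * R * r * Real.cos θ) / (2 * R * r))
      (Real.sin θ * (R ^ 2 + r ^ 2 - 2 * R * r * Real.cos θ)⁻¹) θ := by
    intro θ _
    have h := ((((Real.hasDerivAt_cos θ).const_mul (2 * R * r)).const_sub
      (R ^ 2 + r ^ 2)).log (hpos θ).ne').div_const (2 * R * r)
    have := (hpos θ).ne'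
    refine h.congr_deriv ?_
    field_simp
  have hint := intervalIntegral.integral_eq_sub_of_hasDerivAt hderiv
    (hcont.intervalIntegrable _ _)
  rw [intervalIntegral.integral_of_le Real.pi_pos.le, integral_Ioc_eq_integral_Ioo] at hint
  have hval : ∫ θ in Set.Ioo 0 Real.pi,
      Real.sin θ * (R ^ 2 + r ^ 2 - 2 * R * r * Real.cos θ)⁻¹ =
      (Real.log (R + r) - Real.log (R - r)) / (R * r) := by
    rw [hint, Real.cos_pi, Real.cos_zero,
      show R ^ 2 + r ^ 2 - 2 * R * r * (-1) = (R + r) ^ 2 by ring,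
      show R ^ 2 + r ^ 2 - 2 * R * r * 1 = (R - r) ^ 2 by ring, Real.log_pow, Real.log_pow]
    field_simp
    push_cast
    ring
  rw [← hval, ofReal_integral_eq_lintegral_ofReal]
  · refine setLIntegral_congr_fun measurableSet_Ioo fun θ hθ => ?_
    exact (ENNReal.ofReal_mul (Real.sin_pos_of_pos_of_lt_pi hθ.1 hθ.2).le).symm
  · exact (hcont.integrableOn_Icc (a := 0) (b := Real.pi)).mono_set Set.Ioo_subset_Icc_self
  · filter_upwards [ae_restrict_mem measurableSet_Ioo] with θ hθ
    exact mul_nonneg (Real.sin_pos_of_pos_of_lt_pi hθ.1 hθ.2).le (inv_nonneg.2 (hpos θ).le)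

/-- The function `x ↦ (log (1 + x) - log (1 - x)) / x` is increasing: its power series has
nonnegative coefficients. -/
theorem log_sub_log_div_le {r a R : ℝ} (hr : 0 < r) (hra : r ≤ a) (haR : a < R) :
    (Real.log (R + r) - Real.log (R - r)) / r ≤ (Real.log (R + a) - Real.log (R - a)) / a := by
  have ha : 0 < a := hr.trans_le hra
  have hR : 0 < R := ha.trans haR
  have key : ∀ s : ℝ, 0 < s → s < R →
      HasSum (fun n : ℕ => 2 * (1 / (2 * (n : ℝ) + 1)) * (s / R) ^ (2 * n) / R)
        ((Real.log (R + s) - Real.log (R - s)) / s) := by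
    intro s hs hsR
    have hlt : s / R < 1 := (div_lt_one hR).2 hsR
    have h := (Real.hasSum_log_sub_log_of_abs_lt_one (x := s / R)
      (by rw [abs_of_pos (by positivity)]; exact hlt)).div_const s
    have e1 : Real.log (R + s) = Real.log R + Real.log (1 + s / R) := by
      rw [← Real.log_mul hR.ne' (by positivity)]
      congr 1; field_simp
    have e2 : Real.log (R - s) = Real.log R + Real.log (1 - s / R) := by
      rw [← Real.log_mul hR.ne' (by linarith)]
      congr 1; field_simp
    rw [e1, e2, add_sub_add_left_eq_sub]
    convert! h using 2 with n
    rw [pow_succ]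
    field_simp
  refine hasSum_le (fun n => ?_) (key r hr (hra.trans_lt haR)) (key a ha haR)
  gcongr

/-! ### Bounds for the Green's function -/

theorem green_nonneg (k : ℝ) (x y : R3) : 0 ≤ green k x y := by
  unfold green; positivity

theorem green_comm (k : ℝ) (x y : R3) : green k x y = green k y x := by
  simp only [green, norm_sub_rev]

theorem measurable_green {α : Type*} [MeasurableSpace α] (k : ℝ) {f g : α → R3}
    (hf : Measurable f) (hg : Measurable g) : Measurable fun t => green k (f t) (g t) := by
  unfold green; fun_prop

theorem green_le {k : ℝ} (hk : 0 ≤ k) (x y : R3) : green k x y ≤ (4 * Real.pi * ‖x - y‖)⁻¹ := by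
  rw [green, div_eq_mul_inv]
  refine mul_le_of_le_one_left (by positivity) (Real.exp_le_one_iff.2 ?_)
  rw [neg_mul]
  exact neg_nonpos.2 (by positivity)

theorem green_sq_le {k : ℝ} (hk : 0 ≤ k) (x y : R3) :
    ENNReal.ofReal (green k x y) ^ 2 ≤
      ENNReal.ofReal (16 * Real.pi ^ 2)⁻¹ * ENNReal.ofReal (‖x - y‖ ^ 2)⁻¹ := by
  rw [← ENNReal.ofReal_pow (green_nonneg k x y), ← ENNReal.ofReal_mul (by positivity),
    ← mul_inv, show 16 * Real.pi ^ 2 * ‖x - y‖ ^ 2 = (4 * Real.pi * ‖x - y‖) ^ 2 by ring, ← inv_pow]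
  exact ENNReal.ofReal_le_ofReal (pow_le_pow_left₀ (green_nonneg k x y) (green_le hk x y) 2)

/-- The bound `sup_{z ∈ B_a} ‖G(·, z)‖²_{L²(∂B_R)}` that enters `nu`. The center of the ball, where
the formula for the integral degenerates, is left out. -/
theorem lintegral_sphereMeasure_green_sq_le {k a R : ℝ} (hk : 0 ≤ k) (haR : a < R) {z : R3}
    (hz : z ≠ 0) (hza : ‖z‖ ≤ a) :
    ∫⁻ x, ENNReal.ofReal (green k x z) ^ 2 ∂(sphereMeasure R) ≤
      ENNReal.ofReal (R / (16 * Real.pi * a) * Real.log |(R + a) ^ 2 / (R - a) ^ 2|) := by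
  have hr : 0 < ‖z‖ := norm_pos_iff.2 hz
  set r := ‖z‖ with hrdef
  have ha : 0 < a := hr.trans_le hza
  have hR : 0 < R := ha.trans haR
  have hmap : Measurable fun ω : Metric.sphere (0 : R3) 1 => R • (ω : R3) := by fun_prop
  have hm : Measurable fun x : R3 => ENNReal.ofReal (‖x - z‖ ^ 2)⁻¹ := by fun_prop
  have hf : Measurable fun t : ℝ => ENNReal.ofReal (R ^ 2 + r ^ 2 - 2 * R * r * t)⁻¹ := by fun_prop
  have he : ‖r⁻¹ • z‖ = 1 := by
    rw [norm_smul, norm_inv, Real.norm_of_nonneg hr.le, ← hrdef, inv_mul_cancel₀ hr.ne']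
  calc ∫⁻ x, ENNReal.ofReal (green k x z) ^ 2 ∂(sphereMeasure R)
      ≤ ∫⁻ x, ENNReal.ofReal (16 * Real.pi ^ 2)⁻¹ * ENNReal.ofReal (‖x - z‖ ^ 2)⁻¹
          ∂(sphereMeasure R) := lintegral_mono fun x => green_sq_le hk x z
    _ = ENNReal.ofReal (16 * Real.pi ^ 2)⁻¹ * (ENNReal.ofReal (R ^ 2) *
          ∫⁻ ω : Metric.sphere (0 : R3) 1, ENNReal.ofReal (‖R • (ω : R3) - z‖ ^ 2)⁻¹
            ∂(volume : Measure R3).toSphere) := by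
        rw [lintegral_const_mul _ hm, sphereMeasure, lintegral_smul_measure,
          lintegral_map hm hmap, smul_eq_mul]
    _ = ENNReal.ofReal (16 * Real.pi ^ 2)⁻¹ * (ENNReal.ofReal (R ^ 2) *
          ∫⁻ ω : Metric.sphere (0 : R3) 1,
            ENNReal.ofReal (R ^ 2 + r ^ 2 - 2 * R * r * inner ℝ (r⁻¹ • z) (ω : R3))⁻¹
            ∂(volume : Measure R3).toSphere) := by
        congr 3
        ext ω
        congr 2
        have hω : ‖(ω : R3)‖ = 1 := by simp
        rw [norm_sub_sq_real, norm_smul, Real.norm_of_nonneg hR.le, hω, real_inner_smul_left,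
          real_inner_smul_left, real_inner_comm z, ← hrdef]
        field_simp
        ring
    _ = ENNReal.ofReal ((16 * Real.pi ^ 2)⁻¹ * (R ^ 2 * (2 * Real.pi *
          ((Real.log (R + r) - Real.log (R - r)) / (R * r))))) := by
        rw [lintegral_toSphere_inner hf he, lintegral_sin_div hr (hza.trans_lt haR),
          ENNReal.ofReal_mul (p := (16 * Real.pi ^ 2)⁻¹) (by positivity),
          ENNReal.ofReal_mul (p := R ^ 2) (by positivity),
          ENNReal.ofReal_mul (p := 2 * Real.pi) (by positivity)]
    _ ≤ _ := by
        refine ENNReal.ofReal_le_ofReal ?_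
        have hlog : Real.log |(R + a) ^ 2 / (R - a) ^ 2| =
            2 * (Real.log (R + a) - Real.log (R - a)) := by
          have : R - a ≠ 0 := (sub_pos.2 haR).ne'
          rw [Real.log_abs, Real.log_div (by positivity) (by positivity), Real.log_pow,
            Real.log_pow]
          push_cast; ring
        have hmono := log_sub_log_div_le hr hza haR
        calc _ = R / (8 * Real.pi) * ((Real.log (R + r) - Real.log (R - r)) / r) := by
              field_simp; ring
          _ ≤ R / (8 * Real.pi) * ((Real.log (R + a) - Real.log (R - a)) / a) := by gcongr
          _ = _ := by rw [hlog]; field_simp; ring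

theorem lintegral_ball_inv_sq {a : ℝ} (ha : 0 < a) :
    ∫⁻ z in Metric.ball (0 : R3) a, ENNReal.ofReal (‖z‖ ^ 2)⁻¹ =
      ENNReal.ofReal (4 * Real.pi * a) := by
  rw [← lintegral_indicator measurableSet_ball, lintegral_eq_lintegral_toSphere
    (Measurable.indicator (by fun_prop) measurableSet_ball)]
  have h : ∀ ω : Metric.sphere (0 : R3) 1, ∫⁻ r in Set.Ioi (0 : ℝ), ENNReal.ofReal (r ^ 2) *
      (Metric.ball (0 : R3) a).indicator (fun z => ENNReal.ofReal (‖z‖ ^ 2)⁻¹) (r • (ω : R3)) =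
      ENNReal.ofReal a := by
    intro ω
    calc _ = ∫⁻ r in Set.Ioo (0 : ℝ) a, 1 := by
          rw [← lintegral_indicator measurableSet_Ioi, ← lintegral_indicator measurableSet_Ioo]
          refine lintegral_congr fun r => ?_
          by_cases h0 : 0 < r
          · have hn : ‖r • (ω : R3)‖ = r := by simp [norm_smul, abs_of_pos h0]
            by_cases h1 : r < a
            · rw [Set.indicator_of_mem (show r ∈ Set.Ioi 0 from h0),
                Set.indicator_of_mem (show r ∈ Set.Ioo 0 a from ⟨h0, h1⟩),
                Set.indicator_of_mem (by rwa [mem_ball_zero_iff, hn]), hn,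
                ← ENNReal.ofReal_mul (by positivity), mul_inv_cancel₀ (by positivity),
                ENNReal.ofReal_one]
            · rw [Set.indicator_of_mem (show r ∈ Set.Ioi 0 from h0),
                Set.indicator_of_notMem (show r ∉ Set.Ioo 0 a from fun h => h1 h.2),
                Set.indicator_of_notMem (by rwa [mem_ball_zero_iff, hn]), mul_zero]
          · rw [Set.indicator_of_notMem (show r ∉ Set.Ioi 0 from h0),
                Set.indicator_of_notMem (show r ∉ Set.Ioo 0 a from fun h => h0 h.1)]
      _ = _ := by simp
  simp_rw [h]
  rw [lintegral_const, Measure.toSphere_apply_univ, EuclideanSpace.volume_ball_fin_three,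
    finrank_euclideanSpace_fin, ENNReal.ofReal_one, one_pow, one_mul,
    show ((3 : ℕ) : ℝ≥0∞) = ENNReal.ofReal 3 by simp,
    ← ENNReal.ofReal_mul (by norm_num), ← ENNReal.ofReal_mul ha.le]
  congr 1; ring

/-- Among balls of radius `a`, the one centered at the pole maximizes the integral of
`z ↦ |x - z|⁻²`: the integrand is at most `a⁻²` outside of it and at least `a⁻²` inside. -/
theorem lintegral_ball_inv_sq_sub_le {a : ℝ} (ha : 0 < a) (x : R3) :
    ∫⁻ z in Metric.ball (0 : R3) a, ENNReal.ofReal (‖x - z‖ ^ 2)⁻¹ ≤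
      ENNReal.ofReal (4 * Real.pi * a) := by
  set f : R3 → ℝ≥0∞ := fun z => ENNReal.ofReal (‖x - z‖ ^ 2)⁻¹ with hf
  set D := Metric.ball (0 : R3) a
  set D' := Metric.ball x a
  set c : ℝ≥0∞ := ENNReal.ofReal (a ^ 2)⁻¹
  have hD : MeasurableSet D := measurableSet_ball
  have hD' : MeasurableSet D' := measurableSet_ball
  have hvol : volume (D \ D') = volume (D' \ D) := by
    have h : volume D = volume D' := by
      simp only [D, D', EuclideanSpace.volume_ball_fin_three]
    have h1 := measure_inter_add_sdiff (μ := volume) D hD'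
    have h2 := measure_inter_add_sdiff (μ := volume) D' hD
    rw [Set.inter_comm] at h2
    have hfin : volume (D ∩ D') ≠ ∞ :=
      ((measure_mono Set.inter_subset_left).trans_lt measure_ball_lt_top).ne
    exact (ENNReal.add_right_inj hfin).1 (h1.trans (h.trans h2.symm))
  have hout : ∫⁻ z in D \ D', f z ≤ c * volume (D \ D') := by
    rw [← setLIntegral_const]
    refine setLIntegral_mono' (hD.diff hD') fun z hz => ENNReal.ofReal_le_ofReal ?_
    have : a ≤ ‖x - z‖ := by
      rw [norm_sub_rev]; exact not_lt.1 fun h => hz.2 (mem_ball_iff_norm.2 h)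
    gcongr
  have hin : c * volume (D' \ D) ≤ ∫⁻ z in D' \ D, f z := by
    rw [← setLIntegral_const]
    refine setLIntegral_mono_ae' (hD'.diff hD) ?_
    -- at the pole itself the junk value of the inverse is `0`
    have hne : ∀ᵐ z : R3, z ≠ x := by simp [ae_iff]
    filter_upwards [hne] with z hzx hz
    refine ENNReal.ofReal_le_ofReal ?_
    have h1 : ‖x - z‖ < a := by rw [norm_sub_rev]; exact mem_ball_iff_norm.1 hz.1
    have h2 : 0 < ‖x - z‖ := norm_pos_iff.2 (sub_ne_zero.2 hzx.symm)
    gcongr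
  calc ∫⁻ z in D, f z = (∫⁻ z in D ∩ D', f z) + ∫⁻ z in D \ D', f z :=
        (lintegral_inter_add_sdiff f D hD').symm
    _ ≤ (∫⁻ z in D' ∩ D, f z) + ∫⁻ z in D' \ D, f z := by
        rw [Set.inter_comm]
        exact add_le_add le_rfl (hout.trans ((congrArg (c * ·) hvol).le.trans hin))
    _ = ∫⁻ z in D', f z := lintegral_inter_add_sdiff f D' hD
    _ = ∫⁻ z in D, ENNReal.ofReal (‖z‖ ^ 2)⁻¹ := by
        rw [← (measurePreserving_sub_right volume x).setLIntegral_comp_preimage hD (by fun_prop)]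
        have : (fun z => z - x) ⁻¹' D = D' := by
          ext z; simp [D, D', dist_eq_norm]
        rw [this]
        simp only [hf, norm_sub_rev]
    _ = _ := lintegral_ball_inv_sq ha

theorem lintegral_ballMeasure_green_sq_le {k a : ℝ} (hk : 0 ≤ k) (ha : 0 < a) (x : R3) :
    ∫⁻ z, ENNReal.ofReal (green k x z) ^ 2 ∂(ballMeasure a) ≤
      ENNReal.ofReal (a / (4 * Real.pi)) := by
  calc ∫⁻ z, ENNReal.ofReal (green k x z) ^ 2 ∂(ballMeasure a)
      ≤ ∫⁻ z, ENNReal.ofReal (16 * Real.pi ^ 2)⁻¹ * ENNReal.ofReal (‖x - z‖ ^ 2)⁻¹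
          ∂(ballMeasure a) := lintegral_mono fun z => green_sq_le hk x z
    _ ≤ ENNReal.ofReal (16 * Real.pi ^ 2)⁻¹ * ENNReal.ofReal (4 * Real.pi * a) := by
        rw [lintegral_const_mul _ (by fun_prop)]
        gcongr
        exact lintegral_ball_inv_sq_sub_le ha x
    _ = _ := by
        rw [← ENNReal.ofReal_mul (by positivity)]
        congr 1
        field_simp
        ring

/-! ### Integrals of chains of kernels -/

section Chain

variable {α β : Type*}

/-- The weight `g(z₀,z₁) g(z₁,z₂) ⋯ g(z_{n-1},z_n) w₀(z₀) ⋯ w_n(z_n)`. -/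
noncomputable def chain (g : α → α → ℝ≥0∞) {n : ℕ} (w : Fin (n + 1) → α → ℝ≥0∞)
    (z : Fin (n + 1) → α) : ℝ≥0∞ :=
  (∏ i : Fin n, g (z i.castSucc) (z i.succ)) * ∏ i, w i (z i)

theorem chain_cons (g : α → α → ℝ≥0∞) {n : ℕ} (w : Fin (n + 2) → α → ℝ≥0∞) (x : α)
    (z : Fin (n + 1) → α) :
    chain g w (Fin.cons x z) = w 0 x * (g x (z 0) * chain g (fun i => w i.succ) z) := by
  rw [chain, chain, Fin.prod_univ_succ, Fin.prod_univ_succ]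
  simp only [Fin.castSucc_zero, Fin.cons_zero, Fin.cons_succ, Fin.castSucc_succ]
  ring

variable [MeasurableSpace α] [MeasurableSpace β]

/-- The Cauchy–Schwarz inequality for the Lebesgue integral of nonnegative functions. -/
theorem lintegral_mul_sq_le (m : Measure α) {f g : α → ℝ≥0∞} (hf : AEMeasurable f m)
    (hg : AEMeasurable g m) :
    (∫⁻ x, f x * g x ∂m) ^ 2 ≤ (∫⁻ x, f x ^ 2 ∂m) * ∫⁻ x, g x ^ 2 ∂m := by
  have h := ENNReal.lintegral_mul_le_Lp_mul_Lq m Real.HolderConjugate.two_two hf hg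
  have hsq : ∀ t : ℝ≥0∞, (t ^ (1 / 2 : ℝ)) ^ 2 = t := fun t => by
    rw [← ENNReal.rpow_natCast, ← ENNReal.rpow_mul]; norm_num
  simp only [ENNReal.rpow_ofNat, Pi.mul_apply] at h
  calc _ ≤ _ := pow_le_pow_left' h 2
    _ = _ := by rw [mul_pow, hsq, hsq]

theorem lintegral_mul_le_mul (m : Measure α) {f g : α → ℝ≥0∞} (hf : AEMeasurable f m)
    (hg : AEMeasurable g m) {A B : ℝ≥0∞} (hA : ∫⁻ x, f x ^ 2 ∂m ≤ A ^ 2)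
    (hB : ∫⁻ x, g x ^ 2 ∂m ≤ B ^ 2) : ∫⁻ x, f x * g x ∂m ≤ A * B := by
  rw [← ENNReal.pow_le_pow_left_iff two_ne_zero, mul_pow]
  exact (lintegral_mul_sq_le m hf hg).trans (mul_le_mul' hA hB)

theorem measurable_chain {g : α → α → ℝ≥0∞} (hg : Measurable (Function.uncurry g)) {n : ℕ}
    {w : Fin (n + 1) → α → ℝ≥0∞} (hw : ∀ i, Measurable (w i)) : Measurable (chain g w) := by
  refine Measurable.mul ?_ ?_
  · exact Finset.measurable_fun_prod _ fun i _ =>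
      hg.comp (f := fun z : Fin (n + 1) → α => (z i.castSucc, z i.succ)) (by fun_prop)
  · exact Finset.measurable_fun_prod _ fun i _ => (hw i).comp (measurable_pi_apply _)

theorem lintegral_pi_succ (m : Measure α) [SigmaFinite m] {n : ℕ} {H : (Fin (n + 1) → α) → ℝ≥0∞}
    (hH : Measurable H) :
    ∫⁻ z, H z ∂(Measure.pi fun _ => m) =
      ∫⁻ x, ∫⁻ z, H (Fin.cons x z) ∂(Measure.pi fun _ : Fin n => m) ∂m := by
  have h := (measurePreserving_piFinSuccAbove (fun _ : Fin (n + 1) => m) 0).symm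
  rw [← h.lintegral_comp hH, lintegral_prod]
  · simp [MeasurableEquiv.piFinSuccAbove_symm_apply, Fin.insertNthEquiv]
  · exact (hH.comp h.measurable).aemeasurable

variable {m : Measure α} [SigmaFinite m] {g : α → α → ℝ≥0∞} {M : ℝ≥0∞}

/-- Each application of a kernel whose rows are bounded by `M` in `L²` costs, by Cauchy–Schwarz, a
factor `M` times the `L²` norm of the weight. -/
theorem lintegral_mul_chain_le (hg : Measurable (Function.uncurry g))
    (hM : ∀ x, ∫⁻ z, g x z ^ 2 ∂m ≤ M ^ 2) {n : ℕ} {w : Fin (n + 1) → α → ℝ≥0∞}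
    (hw : ∀ i, Measurable (w i)) {N : Fin (n + 1) → ℝ≥0∞}
    (hN : ∀ i, ∫⁻ z, w i z ^ 2 ∂m ≤ N i ^ 2) (x : α) :
    ∫⁻ z, g x (z 0) * chain g w z ∂(Measure.pi fun _ => m) ≤ M ^ (n + 1) * ∏ i, N i := by
  have hgx : ∀ x, Measurable (g x) := fun x => hg.comp measurable_prodMk_left
  have hH : ∀ (x : α) {n : ℕ} {w : Fin (n + 1) → α → ℝ≥0∞}, (∀ i, Measurable (w i)) →
      Measurable fun z : Fin (n + 1) → α => g x (z 0) * chain g w z := fun x _ _ hw =>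
    ((hgx x).comp (measurable_pi_apply _)).mul (measurable_chain hg hw)
  induction n generalizing x with
  | zero =>
    rw [lintegral_pi_succ m (hH x hw)]
    simpa [chain] using lintegral_mul_le_mul m (hgx x).aemeasurable (hw 0).aemeasurable (hM x)
      (hN 0)
  | succ n ih =>
    rw [lintegral_pi_succ m (hH x hw)]
    simp only [chain_cons, Fin.cons_zero]
    have hw' : ∀ i : Fin (n + 1), Measurable (w i.succ) := fun i => hw _
    calc _ ≤ ∫⁻ y, g x y * w 0 y * (M ^ (n + 1) * ∏ i : Fin (n + 1), N i.succ) ∂m := by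
          refine lintegral_mono fun y => ?_
          simp only [← mul_assoc (g x y)]
          rw [lintegral_const_mul _ (hH y hw')]
          exact mul_le_mul_right (ih hw' (fun i => hN i.succ) y) _
      _ ≤ M * N 0 * (M ^ (n + 1) * ∏ i : Fin (n + 1), N i.succ) := by
          rw [lintegral_mul_const _ (f := fun y => g x y * w 0 y) ((hgx x).mul (hw 0))]
          exact mul_le_mul_left (lintegral_mul_le_mul m (hgx x).aemeasurable
            (hw 0).aemeasurable (hM x) (hN 0)) _
      _ = _ := by rw [Fin.prod_univ_succ (n := n + 1)]; ring

theorem lintegral_chain_le (hg : Measurable (Function.uncurry g))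
    (hM : ∀ x, ∫⁻ z, g x z ^ 2 ∂m ≤ M ^ 2) {V : ℝ≥0∞} (hV : m Set.univ ≤ V ^ 2) {n : ℕ}
    {w : Fin (n + 1) → α → ℝ≥0∞} (hw : ∀ i, Measurable (w i)) {N : Fin (n + 1) → ℝ≥0∞}
    (hN : ∀ i, ∫⁻ z, w i z ^ 2 ∂m ≤ N i ^ 2) :
    ∫⁻ z, chain g w z ∂(Measure.pi fun _ => m) ≤ V * M ^ n * ∏ i, N i := by
  have h0 : ∫⁻ x, w 0 x ∂m ≤ V * N 0 := by
    simpa using lintegral_mul_le_mul m (f := 1) aemeasurable_const (hw 0).aemeasurable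
      (by simpa using hV) (hN 0)
  rw [lintegral_pi_succ m (measurable_chain hg hw)]
  cases n with
  | zero => simpa [chain] using h0
  | succ n =>
    have hw' : ∀ i : Fin (n + 1), Measurable (w i.succ) := fun i => hw _
    simp only [chain_cons]
    calc _ ≤ ∫⁻ y, w 0 y * (M ^ (n + 1) * ∏ i : Fin (n + 1), N i.succ) ∂m := by
          refine lintegral_mono fun y => ?_
          have hm : Measurable fun z : Fin (n + 1) → α =>
              g y (z 0) * chain g (fun i => w i.succ) z :=
            ((hg.comp measurable_prodMk_left).comp (measurable_pi_apply _)).mul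
              (measurable_chain hg hw')
          rw [lintegral_const_mul _ hm]
          exact mul_le_mul_right (lintegral_mul_chain_le hg hM hw' (fun i => hN i.succ) y) _
      _ ≤ V * N 0 * (M ^ (n + 1) * ∏ i : Fin (n + 1), N i.succ) := by
          rw [lintegral_mul_const _ (hw 0)]
          exact mul_le_mul_left h0 _
      _ = _ := by rw [Fin.prod_univ_succ (n := n + 1)]; ring

/-- Attaching a kernel `A` to both ends of a family of weights `c`, with endpoints `p` and `q`:
by Cauchy–Schwarz with respect to the measure `c dρ` and Tonelli's theorem, the `L²` norm of the
resulting function of two variables is at most `∫ c dρ` times the largest value of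
`∫ A(x,z)² dσ(x)`. -/
theorem lintegral_sq_lintegral_mul_le {γ : Type*} [MeasurableSpace γ] (ρ : Measure γ) [SFinite ρ]
    (σ : Measure β) [SFinite σ] {A : β → α → ℝ≥0∞} (hA : Measurable (Function.uncurry A))
    {p q : γ → α} (hp : Measurable p) (hq : Measurable q) {c : γ → ℝ≥0∞} (hc : Measurable c)
    {T W : ℝ≥0∞} (hpT : ∀ᵐ z ∂ρ, ∫⁻ x, A x (p z) ^ 2 ∂σ ≤ T)
    (hqT : ∀ᵐ z ∂ρ, ∫⁻ x, A x (q z) ^ 2 ∂σ ≤ T) (hW : ∫⁻ z, c z ∂ρ ≤ W) :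
    ∫⁻ xy, (∫⁻ z, c z * (A xy.1 (p z) * A xy.2 (q z)) ∂ρ) ^ 2 ∂(σ.prod σ) ≤ (T * W) ^ 2 := by
  set ρc := ρ.withDensity c
  have hρc : ρc Set.univ ≤ W := by
    rw [withDensity_apply _ MeasurableSet.univ, setLIntegral_univ]; exact hW
  have hac : ρc ≪ ρ := withDensity_absolutelyContinuous ρ c
  have hPP : Measurable fun t : (β × β) × γ => A t.1.1 (p t.2) * A t.1.2 (q t.2) :=
    (hA.comp (f := fun t : (β × β) × γ => (t.1.1, p t.2)) (by fun_prop)).mul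
      (hA.comp (f := fun t : (β × β) × γ => (t.1.2, q t.2)) (by fun_prop))
  have hP : ∀ xy : β × β, Measurable fun z => A xy.1 (p z) * A xy.2 (q z) := fun xy =>
    hPP.comp measurable_prodMk_left
  calc _ ≤ ∫⁻ xy, (∫⁻ z, (A xy.1 (p z) * A xy.2 (q z)) ^ 2 ∂ρc) * W ∂(σ.prod σ) := by
        refine lintegral_mono fun xy => ?_
        have h1 : ∫⁻ z, c z * (A xy.1 (p z) * A xy.2 (q z)) ∂ρ =
            ∫⁻ z, A xy.1 (p z) * A xy.2 (q z) * 1 ∂ρc := by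
          simp only [mul_one]
          exact (lintegral_withDensity_eq_lintegral_mul ρ hc (hP xy)).symm
        simp only [h1]
        refine (lintegral_mul_sq_le ρc (hP xy).aemeasurable aemeasurable_const).trans ?_
        refine mul_le_mul_right ?_ _
        simpa using hρc
    _ = (∫⁻ z, ∫⁻ xy, (A xy.1 (p z) * A xy.2 (q z)) ^ 2 ∂(σ.prod σ) ∂ρc) * W := by
        rw [lintegral_mul_const _ ((hPP.pow_const 2).lintegral_prod_right'),
          lintegral_lintegral_swap (hPP.pow_const 2).aemeasurable]
    _ ≤ (∫⁻ _, T * T ∂ρc) * W := by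
        refine mul_le_mul_left (lintegral_mono_ae ?_) _
        filter_upwards [hac.ae_le hpT, hac.ae_le hqT] with z h1 h2
        have hm : ∀ y : α, Measurable fun x => A x y ^ 2 := fun y =>
          (hA.comp measurable_prodMk_right).pow_const 2
        simp only [mul_pow]
        rw [lintegral_prod_mul (hm _).aemeasurable (hm _).aemeasurable]
        exact mul_le_mul' h1 h2
    _ ≤ T * T * W * W := by
        rw [lintegral_const]
        gcongr
    _ = _ := by ring

end Chain

/-! ### Bounds for the forward operators -/

instance (a : ℝ) : IsFiniteMeasure (ballMeasure a) :=
  ⟨by rw [ballMeasure, Measure.restrict_apply_univ]; exact measure_ball_lt_top⟩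

instance (R : ℝ) : IsFiniteMeasure (sphereMeasure R) := by
  have := Measure.isFiniteMeasure_map (volume : Measure R3).toSphere
    fun ω : Metric.sphere (0 : R3) 1 => R • (ω : R3)
  exact Measure.smul_finite _ ENNReal.ofReal_ne_top

theorem lintegral_enorm_sq_eq {α 𝕜 : Type*} [MeasurableSpace α] [NormedAddCommGroup 𝕜]
    {m : Measure α} (f : α → 𝕜) : ∫⁻ z, ‖f z‖ₑ ^ 2 ∂m = eLpNorm f 2 m ^ 2 := by
  have h := eLpNorm_nnreal_pow_eq_lintegral (f := f) (μ := m) (p := 2) two_ne_zero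
  simpa [ENNReal.rpow_ofNat] using h.symm

section Forward

variable {𝕜 : Type*} [RCLike 𝕜] {k a R : ℝ} {n : ℕ}

theorem measurable_ofReal_green (k : ℝ) :
    Measurable (Function.uncurry fun x y : R3 => ENNReal.ofReal (green k x y)) :=
  (measurable_green k measurable_fst measurable_snd).ennreal_ofReal

theorem enorm_bornIntegrand (k : ℝ) (η : Fin (n + 1) → R3 → 𝕜) (x y : R3) (z : Fin (n + 1) → R3) :
    ‖bornIntegrand k η x y z‖ₑ = chain (fun x y => ENNReal.ofReal (green k x y))
        (fun i z => ‖η i z‖ₑ) z *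
      (ENNReal.ofReal (green k x (z 0)) * ENNReal.ofReal (green k y (z (Fin.last n)))) := by
  have hp : ∀ s : Finset (Fin n), 0 ≤ ∏ i ∈ s, green k (z i.castSucc) (z i.succ) := fun s =>
    Finset.prod_nonneg fun i _ => green_nonneg _ _ _
  have hreal : ∀ t : ℝ, 0 ≤ t → ‖(t : 𝕜)‖ₑ = ENNReal.ofReal t := fun t ht => by
    rw [← ofReal_norm, RCLike.norm_ofReal, abs_of_nonneg ht]
  have hprod : ‖∏ i, η i (z i)‖ₑ = ∏ i, ‖η i (z i)‖ₑ := by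
    simp only [enorm_eq_nnnorm, nnnorm_prod, ENNReal.ofNNReal_finsetProd]
  rw [bornIntegrand, enorm_mul, hprod, hreal _ (mul_nonneg (mul_nonneg (green_nonneg _ _ _) (hp _))
      (green_nonneg _ _ _)), ENNReal.ofReal_mul (mul_nonneg (green_nonneg _ _ _) (hp _)),
    ENNReal.ofReal_mul (green_nonneg _ _ _),
    ENNReal.ofReal_prod_of_nonneg fun i _ => green_nonneg _ _ _, chain, green_comm k y]
  ring

theorem stronglyMeasurable_bornIntegrand (k : ℝ) {η : Fin (n + 1) → R3 → 𝕜}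
    (hη : ∀ i, Measurable (η i)) : StronglyMeasurable fun t : (R3 × R3) × (Fin (n + 1) → R3) =>
      bornIntegrand k η t.1.1 t.1.2 t.2 := by
  have hz : ∀ i, Measurable fun t : (R3 × R3) × (Fin (n + 1) → R3) => t.2 i := fun i =>
    (measurable_pi_apply i).comp measurable_snd
  have hx : Measurable fun t : (R3 × R3) × (Fin (n + 1) → R3) => t.1.1 :=
    measurable_fst.comp measurable_fst
  have hy : Measurable fun t : (R3 × R3) × (Fin (n + 1) → R3) => t.1.2 :=
    measurable_snd.comp measurable_fst
  have h1 : Measurable fun t : (R3 × R3) × (Fin (n + 1) → R3) =>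
      ∏ i : Fin n, green k (t.2 i.castSucc) (t.2 i.succ) :=
    Finset.measurable_fun_prod _ fun i _ => measurable_green k (hz _) (hz _)
  have h2 : Measurable fun t : (R3 × R3) × (Fin (n + 1) → R3) => ∏ i, η i (t.2 i) :=
    Finset.measurable_fun_prod _ fun i _ => (hη i).comp (hz i)
  exact ((RCLike.measurable_ofReal.comp (((measurable_green k hx (hz 0)).mul h1).mul
    (measurable_green k (hz (Fin.last n)) hy))).mul h2).stronglyMeasurable

theorem ballMeasure_univ_eq (a : ℝ) :
    ballMeasure a Set.univ =
      ENNReal.ofReal (Real.sqrt (volume.real (Metric.ball (0 : R3) a))) ^ 2 := by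
  rw [← ENNReal.ofReal_pow (Real.sqrt_nonneg _), Real.sq_sqrt measureReal_nonneg, measureReal_def,
    ENNReal.ofReal_toReal measure_ball_lt_top.ne, ballMeasure, Measure.restrict_apply_univ]

/-- The weights of the Born operator of order `n + 1` have total mass at most
`|B_a|^{1/2} (a/4π)^{n/2} ∏ ‖ηᵢ‖`. -/
theorem lintegral_chain_green_le (hk : 0 ≤ k) (ha : 0 < a) (η : Fin (n + 1) → BallL2 𝕜 a) :
    ∫⁻ z, chain (fun x y => ENNReal.ofReal (green k x y)) (fun i z => ‖η i z‖ₑ) z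
        ∂(Measure.pi fun _ => ballMeasure a) ≤
      ENNReal.ofReal (Real.sqrt (volume.real (Metric.ball (0 : R3) a))) *
        ENNReal.ofReal (Real.sqrt (a / (4 * Real.pi))) ^ n * ∏ i, ‖η i‖ₑ := by
  refine lintegral_chain_le (measurable_ofReal_green k) (fun x => ?_) (ballMeasure_univ_eq a).le
    (fun i => (Lp.stronglyMeasurable (η i)).enorm) fun i => ?_
  · rw [← ENNReal.ofReal_pow (Real.sqrt_nonneg _), Real.sq_sqrt (by positivity)]
    exact lintegral_ballMeasure_green_sq_le hk ha x
  · rw [lintegral_enorm_sq_eq, Lp.enorm_def]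

theorem ae_pi_ballMeasure {P : R3 → Prop} (a : ℝ) (i : Fin (n + 1))
    (h : ∀ᵐ z ∂(ballMeasure a), P z) :
    ∀ᵐ z ∂(Measure.pi fun _ : Fin (n + 1) => ballMeasure a), P (z i) :=
  (Measure.tendsto_eval_ae_ae (μ := fun _ : Fin (n + 1) => ballMeasure a)).eventually h

theorem integrable_bornIntegrand (hk : 0 ≤ k) (ha : 0 < a) (haR : a < R)
    (η : Fin (n + 1) → BallL2 𝕜 a) {x y : R3} (hx : ‖x‖ = R) (hy : ‖y‖ = R) :
    Integrable (bornIntegrand k (fun i => (η i : R3 → 𝕜)) x y)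
      (Measure.pi fun _ : Fin (n + 1) => ballMeasure a) := by
  have hm : StronglyMeasurable (bornIntegrand k (fun i => (η i : R3 → 𝕜)) x y) :=
    (stronglyMeasurable_bornIntegrand k fun i =>
      (Lp.stronglyMeasurable (η i)).measurable).comp_measurable
      (g := fun z : Fin (n + 1) → R3 => ((x, y), z)) measurable_prodMk_left
  refine ⟨hm.aestronglyMeasurable, ?_⟩
  -- the endpoints stay at distance at least `R - a` from the ball
  set c : ℝ≥0∞ := ENNReal.ofReal (4 * Real.pi * (R - a))⁻¹
  have hbound : ∀ w : R3, ‖w‖ = R → ∀ᵐ z ∂(ballMeasure a), ENNReal.ofReal (green k w z) ≤ c := by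
    intro w hw
    filter_upwards [ae_restrict_mem measurableSet_ball] with z hz
    have h1 : ‖z‖ < a := mem_ball_zero_iff.1 hz
    have h2 : R - a ≤ ‖w - z‖ := by linarith [norm_sub_norm_le w z]
    have h3 : 0 < R - a := sub_pos.2 haR
    refine ENNReal.ofReal_le_ofReal ((green_le hk w z).trans ?_)
    gcongr
  calc ∫⁻ z, ‖bornIntegrand k (fun i => (η i : R3 → 𝕜)) x y z‖ₑ
        ∂(Measure.pi fun _ : Fin (n + 1) => ballMeasure a)
      ≤ ∫⁻ z, chain (fun x y => ENNReal.ofReal (green k x y)) (fun i z => ‖η i z‖ₑ) z * (c * c)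
        ∂(Measure.pi fun _ : Fin (n + 1) => ballMeasure a) := by
        refine lintegral_mono_ae ?_
        filter_upwards [ae_pi_ballMeasure a 0 (hbound x hx),
          ae_pi_ballMeasure a (Fin.last n) (hbound y hy)] with z h1 h2
        rw [enorm_bornIntegrand]
        gcongr
    _ < ∞ := by
        rw [lintegral_mul_const' _ _ (by finiteness)]
        refine ENNReal.mul_lt_top ((lintegral_chain_green_le hk ha η).trans_lt ?_) (by finiteness)
        exact ENNReal.mul_lt_top (by finiteness) (ENNReal.prod_lt_top fun i _ => enorm_lt_top)

theorem log_abs_div_nonneg (ha : 0 < a) (haR : a < R) :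
    0 ≤ Real.log |(R + a) ^ 2 / (R - a) ^ 2| := by
  rw [abs_of_nonneg (by positivity)]
  refine Real.log_nonneg ((one_le_div (pow_pos (sub_pos.2 haR) 2)).2 ?_)
  nlinarith [ha.trans haR]

theorem nu_nonneg (ha : 0 < a) (haR : a < R) : 0 ≤ nu k a R := by
  have hlog := log_abs_div_nonneg ha haR
  have := ha.trans haR
  unfold nu
  positivity

theorem mu_pos (hk : 0 < k) (ha : 0 < a) : 0 < mu k a := by
  unfold mu; positivity

/-- The bound `‖K_m(η₁, …, η_m)‖ ≤ ν μ^{m-1} ‖η₁‖ ⋯ ‖η_m‖` with `m = n + 1`. -/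
theorem eLpNorm_bornFunction_le (hk : 0 ≤ k) (ha : 0 < a) (haR : a < R)
    (η : Fin (n + 1) → BallL2 𝕜 a) :
    eLpNorm (bornFunction k a fun i => (η i : R3 → 𝕜)) 2
        ((sphereMeasure R).prod (sphereMeasure R)) ≤
      ENNReal.ofReal (nu k a R * mu k a ^ n) * ∏ i, ‖η i‖ₑ := by
  set T := ENNReal.ofReal (R / (16 * Real.pi * a) * Real.log |(R + a) ^ 2 / (R - a) ^ 2|) with hT
  set W := ENNReal.ofReal (Real.sqrt (volume.real (Metric.ball (0 : R3) a))) *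
        ENNReal.ofReal (Real.sqrt (a / (4 * Real.pi))) ^ n * ∏ i, ‖η i‖ₑ with hW
  set κ := ENNReal.ofReal ((k ^ 2) ^ (n + 1)) with hκ
  have hA := measurable_ofReal_green k
  have hae : ∀ᵐ z ∂(ballMeasure a),
      ∫⁻ x, ENNReal.ofReal (green k x z) ^ 2 ∂(sphereMeasure R) ≤ T := by
    have hne : ∀ᵐ z ∂(ballMeasure a), z ≠ 0 := ae_restrict_of_ae (by simp [ae_iff])
    filter_upwards [hne, ae_restrict_mem measurableSet_ball] with z hz hza
    exact lintegral_sphereMeasure_green_sq_le hk haR hz (mem_ball_zero_iff.1 hza).le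
  have hchain : Measurable (chain (fun x y => ENNReal.ofReal (green k x y))
      (fun i z => ‖η i z‖ₑ)) :=
    measurable_chain hA fun i => (Lp.stronglyMeasurable (η i)).enorm
  have hsq : eLpNorm (bornFunction k a fun i => (η i : R3 → 𝕜)) 2
      ((sphereMeasure R).prod (sphereMeasure R)) ^ 2 ≤ (κ * (T * W)) ^ 2 := by
    rw [← lintegral_enorm_sq_eq, mul_pow κ]
    refine le_trans ?_ (mul_le_mul_right (lintegral_sq_lintegral_mul_le
      (Measure.pi fun _ : Fin (n + 1) => ballMeasure a) (sphereMeasure R) hA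
      (measurable_pi_apply 0) (measurable_pi_apply (Fin.last n)) hchain (T := T)
      (ae_pi_ballMeasure a 0 hae) (ae_pi_ballMeasure a (Fin.last n) hae)
      (lintegral_chain_green_le hk ha η)) _)
    rw [← lintegral_const_mul' _ _ (by finiteness)]
    refine lintegral_mono fun p => ?_
    rw [← mul_pow]
    refine pow_le_pow_left' ?_ 2
    have hc : ‖((-(-k ^ 2) ^ (n + 1) : ℝ) : 𝕜)‖ₑ = κ := by
      rw [← ofReal_norm, RCLike.norm_ofReal, hκ]
      simp [abs_pow]
    rw [bornFunction, enorm_mul, hc]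
    refine mul_le_mul_right ((enorm_integral_le_lintegral_enorm _).trans_eq ?_) _
    exact lintegral_congr fun z => enorm_bornIntegrand _ _ _ _ _
  refine ((ENNReal.pow_le_pow_left_iff two_ne_zero).1 hsq).trans_eq ?_
  rw [hκ, hT, hW, ← mul_assoc, ← mul_assoc, ← mul_assoc, ← ENNReal.ofReal_pow (Real.sqrt_nonneg _),
    ← ENNReal.ofReal_mul (by positivity)]
  have hR := ha.trans haR
  have hlog : 0 ≤ R / (16 * Real.pi * a) * Real.log |(R + a) ^ 2 / (R - a) ^ 2| :=
    mul_nonneg (by positivity) (log_abs_div_nonneg ha haR)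
  rw [← ENNReal.ofReal_mul (by positivity), ← ENNReal.ofReal_mul (by positivity)]
  congr 2
  rw [nu, mu]
  ring

theorem memLp_bornFunction (hk : 0 ≤ k) (ha : 0 < a) (haR : a < R)
    (η : Fin (n + 1) → BallL2 𝕜 a) :
    MemLp (bornFunction k a fun i => (η i : R3 → 𝕜)) 2
      ((sphereMeasure R).prod (sphereMeasure R)) := by
  refine ⟨?_, (eLpNorm_bornFunction_le hk ha haR η).trans_lt (ENNReal.mul_lt_top (by finiteness)
    (ENNReal.prod_lt_top fun i _ => enorm_lt_top))⟩
  exact (StronglyMeasurable.const_mul (stronglyMeasurable_bornIntegrand k fun i =>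
    (Lp.stronglyMeasurable (η i)).measurable).integral_prod_right _).aestronglyMeasurable

theorem norm_bornOperator_le (hk : 0 ≤ k) (ha : 0 < a) (haR : a < R)
    (η : Fin (n + 1) → BallL2 𝕜 a) :
    ‖bornOperator k a R (n + 1) η‖ ≤ nu k a R * mu k a ^ n * ∏ i, ‖η i‖ := by
  have hmu : 0 ≤ mu k a := by unfold mu; positivity
  have hnu := nu_nonneg (k := k) ha haR
  rw [bornOperator, dif_pos (memLp_bornFunction hk ha haR η), Lp.norm_toLp]
  refine ENNReal.toReal_le_of_le_ofReal (by positivity) ?_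
  refine (eLpNorm_bornFunction_le hk ha haR η).trans_eq ?_
  rw [ENNReal.ofReal_mul (p := nu k a R * mu k a ^ n) (by positivity),
    ENNReal.ofReal_prod_of_nonneg fun i _ => norm_nonneg _]
  simp only [ofReal_norm]

end Forward

/-! ### Convergence of the inverse series -/

section Abstract

variable {𝕜 : Type*} [RCLike 𝕜] {X Y : Type*} [NormedAddCommGroup X] [NormedSpace 𝕜 X]
  [NormedAddCommGroup Y] [NormedSpace 𝕜 Y]

/-- If the forward operators satisfy `‖K_m‖ ≤ ν μ^{m-1}`, then the norms of the terms of the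
inverse series satisfy the corresponding recursive inequality. -/
theorem norm_inverseBornTerm_add_two_le {K : (m : ℕ) → (Fin m → X) → Y} {ν μ : ℝ} (hμ : 0 < μ)
    (hK : ∀ (n : ℕ) (η : Fin (n + 1) → X), ‖K (n + 1) η‖ ≤ ν * μ ^ n * ∏ i, ‖η i‖)
    (K1 : Y →L[𝕜] X) (φ : Y) {C : ℝ} (hC : ‖K1‖ * ν ≤ C) (m : ℕ) :
    ‖inverseBornTerm K K1 φ (m + 2)‖ ≤
      C / μ * ∑ c ∈ ({c | 1 < Composition.length c}.toFinset : Finset (Composition (m + 2))),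
        μ ^ c.length * ∏ j, ‖inverseBornTerm K K1 φ (c.blocksFun j)‖ := by
  have hterm : ∀ c : Composition (m + 2), 1 < c.length →
      ‖K1 (K c.length fun i => inverseBornTerm K K1 φ (c.blocksFun i))‖ ≤
        C / μ * (μ ^ c.length * ∏ j, ‖inverseBornTerm K K1 φ (c.blocksFun j)‖) := by
    intro c hc
    have hgen : ∀ (l : ℕ) (hl : 1 < l) (η : Fin l → X),
        ‖K1 (K l η)‖ ≤ C / μ * (μ ^ l * ∏ j, ‖η j‖) := by
      intro l hl η
      obtain ⟨n, rfl⟩ : ∃ n, l = n + 1 := ⟨l - 1, by omega⟩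
      calc ‖K1 (K (n + 1) η)‖ ≤ ‖K1‖ * (ν * μ ^ n * ∏ i, ‖η i‖) :=
            (K1.le_opNorm _).trans (by gcongr; exact hK n η)
        _ = (‖K1‖ * ν) * (μ ^ n * ∏ i, ‖η i‖) := by ring
        _ ≤ C * (μ ^ n * ∏ i, ‖η i‖) := by gcongr
        _ = _ := by field_simp; ring
    exact hgen _ hc _
  rw [inverseBornTerm, norm_neg, Finset.mul_sum]
  refine (norm_sum_le _ _).trans ?_
  rw [← Finset.sum_subtype (s := ({c | 1 < Composition.length c}.toFinset :
      Finset (Composition (m + 2)))) (p := fun c => 2 ≤ c.length)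
    (fun c => by rw [Set.mem_toFinset]; rfl)
    (f := fun c => ‖K1 (K c.length fun i => inverseBornTerm K K1 φ (c.blocksFun i))‖)]
  exact Finset.sum_le_sum fun c hc => hterm c (by simpa using hc)

/-- The partial sums of the norms stay below `1 / (8Cμ)`. Grouping compositions by their length
bounds the sum up to order `n` by `t + (C/μ) ∑_{j ≥ 2} (μ S)^j`, where `t` is the norm of the first
term and `S` the sum up to order `n - 1`; with `μ t ≤ 1/(16C)` and `μ S ≤ 1/(8C) ≤ 1/8` this is
again at most `1/(8Cμ)`. -/
theorem sum_norm_inverseBornTerm_le {K : (m : ℕ) → (Fin m → X) → Y} {ν μ : ℝ} (hμ : 0 < μ)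
    (hK : ∀ (n : ℕ) (η : Fin (n + 1) → X), ‖K (n + 1) η‖ ≤ ν * μ ^ n * ∏ i, ‖η i‖)
    (K1 : Y →L[𝕜] X) (φ : Y) {C : ℝ} (hC : ‖K1‖ * ν ≤ C) (hC1 : 1 ≤ C)
    (hφ : ‖K1 φ‖ ≤ 1 / (16 * C * μ)) (n : ℕ) :
    ∑ m ∈ Finset.Ico 1 n, ‖inverseBornTerm K K1 φ m‖ ≤ 1 / (8 * C * μ) := by
  have hC0 : 0 < C := by linarith
  induction n with
  | zero => simp; positivity
  | succ n ih =>
    set b : ℕ → ℝ := fun m => ‖inverseBornTerm K K1 φ m‖ with hb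
    set S := ∑ m ∈ Finset.Ico 1 n, b m with hS
    have hS0 : 0 ≤ S := Finset.sum_nonneg fun _ _ => norm_nonneg _
    rcases Nat.eq_zero_or_pos n with rfl | hn
    · simp; positivity
    have hsplit : ∑ m ∈ Finset.Ico 1 (n + 1), b m = b 1 + ∑ m ∈ Finset.Ico 2 (n + 1), b m :=
      Finset.sum_eq_sum_Ico_succ_bot (by omega) _
    have hb1 : b 1 = ‖K1 φ‖ := by simp only [hb, inverseBornTerm]
    set q := μ * S with hq
    have hq0 : 0 ≤ q := by positivity
    have hq1 : q ≤ 1 / (8 * C) := by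
      calc q ≤ μ * (1 / (8 * C * μ)) := mul_le_mul_of_nonneg_left ih hμ.le
        _ = _ := by field_simp
    have hq8 : q ≤ 1 / 8 := hq1.trans (by
      rw [div_le_div_iff₀ (by positivity) (by norm_num)]; linarith)
    have hgeom : ∑ j ∈ Finset.Ico 2 (n + 1), q ^ j ≤ q ^ 2 / (1 - q) :=
      geom_sum_Ico_le_of_lt_one hq0 (by linarith)
    have hrec : ∑ m ∈ Finset.Ico 2 (n + 1), b m ≤
        C / μ * ∑ j ∈ Finset.Ico 2 (n + 1), q ^ j := by
      have haux := FormalMultilinearSeries.radius_right_inv_pos_of_radius_pos_aux1 n b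
        (fun _ => norm_nonneg _) hμ.le zero_le_one
      simp only [one_pow, one_mul] at haux
      calc ∑ m ∈ Finset.Ico 2 (n + 1), b m
          ≤ ∑ m ∈ Finset.Ico 2 (n + 1), C / μ *
              ∑ c ∈ ({c | 1 < Composition.length c}.toFinset : Finset (Composition m)),
                μ ^ c.length * ∏ j, b (c.blocksFun j) := by
            refine Finset.sum_le_sum fun m hm => ?_
            obtain ⟨m, rfl⟩ : ∃ l, m = l + 2 := ⟨m - 2, by have := Finset.mem_Ico.1 hm; omega⟩
            exact norm_inverseBornTerm_add_two_le hμ hK K1 φ hC m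
        _ ≤ C / μ * ∑ j ∈ Finset.Ico 2 (n + 1), q ^ j := by
            rw [← Finset.mul_sum]
            refine mul_le_mul_of_nonneg_left ?_ (by positivity)
            simpa only [hq, mul_pow] using haux
    have hquot : q ^ 2 / (1 - q) ≤ 1 / (16 * C ^ 2) := by
      rw [div_le_iff₀ (by linarith)]
      calc q ^ 2 ≤ (1 / (8 * C)) ^ 2 := by gcongr
        _ = 1 / (16 * C ^ 2) * (1 / 4) := by field_simp; norm_num
        _ ≤ 1 / (16 * C ^ 2) * (1 - q) := by gcongr; linarith
    calc ∑ m ∈ Finset.Ico 1 (n + 1), b m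
        ≤ 1 / (16 * C * μ) + C / μ * (1 / (16 * C ^ 2)) := by
          rw [hsplit, hb1]
          refine add_le_add hφ (hrec.trans ?_)
          gcongr
          exact hgeom.trans hquot
      _ = 1 / (8 * C * μ) := by field_simp; norm_num

theorem seriesConverges_inverseBornTerm [CompleteSpace X] {K : (m : ℕ) → (Fin m → X) → Y}
    {ν μ : ℝ} (hμ : 0 < μ)
    (hK : ∀ (n : ℕ) (η : Fin (n + 1) → X), ‖K (n + 1) η‖ ≤ ν * μ ^ n * ∏ i, ‖η i‖)
    (K1 : Y →L[𝕜] X) (φ : Y) {C : ℝ} (hC : ‖K1‖ * ν ≤ C) (hC1 : 1 ≤ C)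
    (hφ : ‖K1 φ‖ ≤ 1 / (16 * C * μ)) : SeriesConverges (inverseBornTerm K K1 φ) := by
  have hzero : inverseBornTerm K K1 φ 0 = 0 := by rw [inverseBornTerm]
  have hico : ∀ N : ℕ, Finset.Icc 1 N = Finset.Ico 1 (N + 1) := fun N => by ext; simp
  have hsum : Summable fun m => ‖inverseBornTerm K K1 φ (m + 1)‖ := by
    refine summable_of_sum_range_le (c := 1 / (8 * C * μ)) (fun _ => norm_nonneg _) fun n => ?_
    refine le_trans (le_of_eq ?_) (sum_norm_inverseBornTerm_le hμ hK K1 φ hC hC1 hφ (n + 1))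
    rw [Finset.sum_Ico_eq_sum_range]
    simp [add_comm]
  refine ⟨∑' m, inverseBornTerm K K1 φ (m + 1), ?_⟩
  refine (hsum.of_norm.hasSum.tendsto_sum_nat).congr fun N => ?_
  rw [hico, Finset.sum_Ico_eq_sum_range]
  simp [add_comm]

end Abstract

/-- The smallness condition on the data implies `μ ‖K₁φ‖ ≤ 1/(16C)`. -/
theorem one_div_mul_sqrt_sub_le {μ C : ℝ} (hμ : 0 < μ) (hC : 1 ≤ C) :
    1 / (2 * μ) * (Real.sqrt (16 * C ^ 2 + 1) - 4 * C) ≤ 1 / (16 * C * μ) := by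
  have hC0 : 0 < C := by linarith
  have h : Real.sqrt (16 * C ^ 2 + 1) ≤ 4 * C + 1 / (8 * C) := by
    refine Real.sqrt_le_iff.2 ⟨by positivity, ?_⟩
    have : (4 * C + 1 / (8 * C)) ^ 2 = 16 * C ^ 2 + 1 + (1 / (8 * C)) ^ 2 := by
      field_simp; ring
    rw [this]
    linarith [sq_nonneg (1 / (8 * C))]
  calc 1 / (2 * μ) * (Real.sqrt (16 * C ^ 2 + 1) - 4 * C) ≤ 1 / (2 * μ) * (1 / (8 * C)) := by
        gcongr; linarith
    _ = _ := by field_simp; norm_num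

end DiffuseBorn

open DiffuseBorn in
theorem mainTheorem3 {𝕜 : Type*} [RCLike 𝕜] (k a R : ℝ) (hk : 0 < k) (ha : 0 < a) (haR : a < R) :
    (∀ (n : ℕ) (η : Fin (n + 1) → BallL2 𝕜 a),
      (∀ x ∈ Metric.sphere (0 : R3) R, ∀ y ∈ Metric.sphere (0 : R3) R,
        Integrable (bornIntegrand k (fun i => (η i : R3 → 𝕜)) x y)
          (Measure.pi fun _ : Fin (n + 1) => ballMeasure a)) ∧
      MemLp (bornFunction k a fun i => (η i : R3 → 𝕜)) 2
        ((sphereMeasure R).prod (sphereMeasure R))) ∧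
    ∀ (K1 : DataL2 𝕜 R →L[𝕜] BallL2 𝕜 a) (φ : DataL2 𝕜 R) (C : ℝ),
      C = max 1 (‖K1‖ * nu k a R) →
      ‖K1 φ‖ ≤ 1 / (2 * mu k a) * (Real.sqrt (16 * C ^ 2 + 1) - 4 * C) →
      SeriesConverges (inverseBornTerm (bornOperator k a R) K1 φ) := by
  refine ⟨fun n η => ⟨fun x hx y hy => ?_, memLp_bornFunction hk.le ha haR η⟩,
    fun K1 φ C hC hφ => ?_⟩
  · exact integrable_bornIntegrand hk.le ha haR η (mem_sphere_zero_iff_norm.1 hx)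
      (mem_sphere_zero_iff_norm.1 hy)
  · have hmu := mu_pos hk ha
    have hC1 : 1 ≤ C := hC ▸ le_max_left _ _
    exact seriesConverges_inverseBornTerm hmu (fun n η => norm_bornOperator_le hk.le ha haR η) K1 φ
      (hC ▸ le_max_right _ _) hC1 (hφ.trans (one_div_mul_sqrt_sub_le hmu hC1))
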